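/- For an integer $d\times r$ matrix $M=[\mathbf m_1,\dots,\mathbf m_r]$ and a field $K$, the toric ideal $I_M\subset K[x_1,\dots,x_r]$ is the kernel of the $K$-algebra homomorphism $\pi: K[x_1,\dots,x_r]\to K[t_1^{\pm1},\dots,t_d^{\pm1},s]$, $\pi(x_j)=\mathbf t^{\mathbf m_j}s$. Write $M^\sharp$ for $M$ with a zero column added. For $\mathbf c\in\mathbb Z^d$ let $\mathbf c^{(+)},\mathbf c^{(-)}\in\mathbb Z^d_{\ge0}$ have coordinates $\max\{0,c_i\}$ and $\max\{0,-c_i\}$. Let $A=[\mathbf a_1,\dots,\mathbf a_n]\in\mathbb Z_{\ge0}^{d\times n}$ and $B=[\mathbf b_1,\dots,\mathbf b_m]\in\mathbb Z_{\ge0}^{d\times m}$ have no zero columns, and suppose that they are of harmony: for every column $\mathbf a$ of $A^\sharp$ and every column $\mathbf b$ of $B^\sharp$, the vector $(\mathbf a-\mathbf b)^{(+)}$ is a column of $A^\sharp$ and $(\mathbf a-\mathbf b)^{(-)}$ is a column of $B^\sharp$. Let $K$ be a field and let $I_{A^\sharp}\subset K[z,x_1,\dots,x_n]$, $I_{B^\sharp}\subset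 K[z,y_1,\dots,y_m]$ be the toric ideals, where $z$ corresponds to the zero column. Suppose that there are (graded) reverse lexicographic orders $<_A$ on $K[z,\mathbf x]$ and $<_B$ on $K[z,\mathbf y]$ such that - the initial ideals $\mathrm{in}_{<_A}(I_{A^\sharp})$ and $\mathrm{in}_{<_B}(I_{B^\sharp})$ are generated by squarefree monomials; - $x_i<_A x_j$ whenever $i\ne j$ and $\pi(x_i)$ divides $\pi(x_j)$ in $K[t_1,\dots,t_d,s]$ (that is, $\mathbf a_i\le\mathbf a_j$ coordinatewise); - $z<_A x_k$ for $1\le k\le n$ and $z<_B y_k$ for $1\le k\le m$. Let $P\subset\mathbb R^d$ be the convex hull of $\{-\mathbf b_1,\dots,-\mathbf b_m,\mathbf a_1,\dots,\mathbf a_n\}$. Suppose that the origin belongs to the interior of $P$ and that some $d\times d$ minor of the matrix $[-B,A]=[-\mathbf b_1,\dots,-\mathbf b_m,\mathbf a_1,\dots,\mathbf a_n]$ equals $\pm1$. Then $P$ is a Gorenstein Fano (reflexive) polytope: $P$ is an integral convex polytope of dimension $d$, the origin is its only interior integer point, and the dual polytope $P^\vee=\{x\in\mathbb R^d:\langle x,y\rangle\le1\text{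 for all }y\in P\}$ is again an integral polytope. If moreover $P$ is simplicial (every facet is a simplex), then $P$ is a smooth Fano polytope: the $d$ vertices of each facet of $P$ form a $\mathbb Z$-basis of $\mathbb Z^d$. -/

import Mathlib

open scoped Matrix

noncomputable section

namespace HarmonyFano

/-! ### Toric ideals and initial ideals -/

/-- `K[t₁, t₁⁻¹, …, t_d, t_d⁻¹, s]`: the monoid algebra of `ℤᵈ × ℕ`, where the element `(a, k)`
of the monoid stands for the monomial `t ^ a * s ^ k`. -/
abbrev LaurentRing (K : Type*) [Field K] (d : ℕ) : Type _ :=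
  AddMonoidAlgebra K ((Fin d → ℤ) × ℕ)

/-- The homomorphism `π` with `π (x_j) = t ^ a_j * s`, where `a_j` is the `j`-th column of `M`. -/
def toricHom (K : Type*) [Field K] {d : ℕ} {ι : Type*} (M : Matrix (Fin d) ι ℤ) :
    MvPolynomial ι K →ₐ[K] LaurentRing K d :=
  MvPolynomial.aeval fun j => AddMonoidAlgebra.single (M.col j, 1) 1

/-- The toric ideal `I_M`, the kernel of `π`. -/
def toricIdeal (K : Type*) [Field K] {d : ℕ} {ι : Type*} (M : Matrix (Fin d) ι ℤ) :
    Ideal (MvPolynomial ι K) :=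
  RingHom.ker (toricHom K M)

/-- The strict (graded) reverse lexicographic order on exponent vectors induced by a total order
of the variables. The total order is given by its rank function `rk`: the variable `x_i` is
smaller than `x_j` when `rk i < rk j`. We have `u < v` when `deg u < deg v`, or when the degrees
agree and, at the smallest variable where `u` and `v` differ, `v` has the smaller exponent. -/
def RevLexLT {ι : Type*} {N : ℕ} (rk : ι ≃ Fin N) (u v : ι →₀ ℕ) : Prop :=
  u.degree < v.degree ∨
    (u.degree = v.degree ∧ ∃ i, (∀ j, rk j < rk i → u j = v j) ∧ v i < u i)

/-- The initial ideal of `I` with respect to the strict total order `lt` on exponent vectors: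
the ideal generated by the initial monomials of the nonzero elements of `I`. -/
def initialIdeal {K : Type*} [Field K] {ι : Type*} (lt : (ι →₀ ℕ) → (ι →₀ ℕ) → Prop)
    (I : Ideal (MvPolynomial ι K)) : Ideal (MvPolynomial ι K) :=
  Ideal.span {g | ∃ f ∈ I, ∃ u ∈ f.support,
    (∀ v ∈ f.support, v ≠ u → lt v u) ∧ g = MvPolynomial.monomial u 1}

/-- The ideal `J` is generated by squarefree monomials. -/
def IsSquarefreeMonomialIdeal {K : Type*} [Field K] {ι : Type*}
    (J : Ideal (MvPolynomial ι K)) : Prop :=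
  ∃ S : Set (ι →₀ ℕ), (∀ u ∈ S, ∀ i, u i ≤ 1) ∧
    J = Ideal.span ((fun u => MvPolynomial.monomial u (1 : K)) '' S)

/-! ### Matrices -/

/-- The matrix `M♯`: the matrix `M` with a zero column added. The new column has index `none`. -/
def sharp {d : ℕ} {ι : Type*} (M : Matrix (Fin d) ι ℤ) : Matrix (Fin d) (Option ι) ℤ :=
  Matrix.of fun k p => p.elim 0 fun j => M k j

/-- `A` and `B` are of harmony: for every column `a` of `A♯` and every column `b` of `B♯`, the
positive part of `a - b` is a column of `A♯` and the negative part is a column of `B♯`. -/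
def OfHarmony {d n m : ℕ} (A : Matrix (Fin d) (Fin n) ℤ) (B : Matrix (Fin d) (Fin m) ℤ) : Prop :=
  ∀ p q, (∃ p', (sharp A).col p' = ((sharp A).col p - (sharp B).col q)⁺) ∧
    ∃ q', (sharp B).col q' = ((sharp A).col p - (sharp B).col q)⁻

/-- The matrix `[-B, A]`. -/
def negJoin {d n m : ℕ} (A : Matrix (Fin d) (Fin n) ℤ) (B : Matrix (Fin d) (Fin m) ℤ) :
    Matrix (Fin d) (Fin m ⊕ Fin n) ℤ :=
  Matrix.fromCols (-B) A

/-! ### Polytopes -/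

/-- The convex hull in `ℝᵈ` of the columns of an integer matrix. -/
def columnPolytope {d : ℕ} {ι : Type*} (M : Matrix (Fin d) ι ℤ) : Set (Fin d → ℝ) :=
  convexHull ℝ (Set.range fun j k => (M k j : ℝ))

/-- `x` has integer coordinates. -/
def IsIntegerPoint {d : ℕ} (x : Fin d → ℝ) : Prop :=
  ∃ z : Fin d → ℤ, x = fun k => (z k : ℝ)

/-- A convex polytope: the convex hull of finitely many points. -/
def IsConvexPolytope {d : ℕ} (P : Set (Fin d → ℝ)) : Prop :=
  ∃ S : Set (Fin d → ℝ), S.Finite ∧ P = convexHull ℝ S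

/-- An integral convex polytope: all its vertices have integer coordinates. -/
def IsIntegralPolytope {d : ℕ} (P : Set (Fin d → ℝ)) : Prop :=
  IsConvexPolytope P ∧ ∀ v ∈ P.extremePoints ℝ, IsIntegerPoint v

/-- The dimension of the affine hull of `P` (this value is `0` for the empty set). -/
def dimension {d : ℕ} (P : Set (Fin d → ℝ)) : ℕ :=
  Module.finrank ℝ (vectorSpan ℝ P)

/-- The dual polytope `{x | ⟨x, y⟩ ≤ 1 for all y ∈ P}`. -/
def dualPolytope {d : ℕ} (P : Set (Fin d → ℝ)) : Set (Fin d → ℝ) :=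
  {x | ∀ y ∈ P, x ⬝ᵥ y ≤ 1}

/-- A Fano polytope: an integral convex polytope of dimension `d` in `ℝᵈ` whose only interior
integer point is the origin. -/
def IsFano {d : ℕ} (P : Set (Fin d → ℝ)) : Prop :=
  IsIntegralPolytope P ∧ dimension P = d ∧ {x | x ∈ interior P ∧ IsIntegerPoint x} = {0}

/-- A Gorenstein Fano (reflexive) polytope: a Fano polytope whose dual is an integral polytope. -/
def IsGorensteinFano {d : ℕ} (P : Set (Fin d → ℝ)) : Prop :=
  IsFano P ∧ IsIntegralPolytope (dualPolytope P)

/-- A facet of the polytope `P`: a nonempty face, cut out by a supporting hyperplane, of dimension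
`dim P - 1`. -/
def IsFacet {d : ℕ} (P F : Set (Fin d → ℝ)) : Prop :=
  F.Nonempty ∧ IsExposed ℝ P F ∧ dimension F + 1 = dimension P

/-- A simplicial polytope: each facet is a simplex. -/
def IsSimplicial {d : ℕ} (P : Set (Fin d → ℝ)) : Prop :=
  IsConvexPolytope P ∧ ∀ F, IsFacet P F →
    AffineIndependent ℝ (fun v : F.extremePoints ℝ => (v : Fin d → ℝ))

/-- A smooth Fano polytope: a simplicial Fano polytope such that the `d` vertices of each facet
form a `ℤ`-basis of `ℤᵈ`. -/
def IsSmoothFano {d : ℕ} (P : Set (Fin d → ℝ)) : Prop :=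
  IsFano P ∧ IsSimplicial P ∧ ∀ F, IsFacet P F →
    ∃ b : Module.Basis (Fin d) ℤ (Fin d → ℤ),
      F.extremePoints ℝ = Set.range fun i k => (b i k : ℝ)

end HarmonyFano

end

/-!
For a set of vectors consider the least number of its elements that add up to a given integer
vector. The theorem rests on the homogeneity of this number: writing `N • γ` takes `N` times as many
summands as writing `γ`.

For the columns of `A` alone, homogeneity follows from the squarefree initial ideal
(`exists_isSum_of_nsmul`): since `z` is the smallest variable, a standard monomial has the largest
possible power of `z` in its fibre, so that its other variables give a shortest representation;
and powers of standard monomials are standard when the initial ideal is squarefree. The same holds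
for `B`. Harmony allows one to replace, in a difference of a sum of columns of `A` and a sum of
columns of `B`, any two columns by columns with disjoint supports without changing the number of
summands (`isSum_posPart_sub`). Hence some shortest representation of `γ` by columns of `[-B, A]`
consists of a shortest representation of `γ⁺` over `A` and one of `γ⁻` over `B`, and homogeneity
holds for `[-B, A]` too. Since the origin is interior and some maximal minor is `±1`, every integer
vector has such a representation (`exists_eq_sum_nsmul_col`).

By rounding the coefficients of large multiples, homogeneity implies that an integer vector that is
a combination of columns with nonnegative real coefficients of sum `c` is a sum of at most `c`
columns (`hasIntegerDecomposition_of_homogeneous`). Consequently the origin is the only interior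
integer point of `P`. Moreover, if the columns on a supporting hyperplane `⟨x, ·⟩ = 1` span `ℝᵈ`,
then they generate `ℤᵈ` (`mem_span_tight_columns`): an integer vector `γ` in their cone is a sum of
at most `⟨x, γ⟩` columns, all of which must lie on the hyperplane. Applied to the vertices `x` of
the dual polytope, this shows that `x` is integral. Applied to a simplicial facet, it shows that the
columns on the facet generate `ℤᵈ`. These columns are exactly the `d` vertices, because harmony and
homogeneity force all entries of `A` and `B` to be `0` or `1` (`apply_le_one_of_harmony`), and such
columns are in convex position (`castVec_mem_of_mem_convexHull`).
-/

namespace HarmonyFano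

/-! ### Sums of elements of a set, and harmony -/

/-- `g` is a sum of exactly `k` elements of `S`, repetitions allowed. In the applications `0 ∈ S`,
so that this means a sum of at most `k` nonzero elements of `S`. -/
def IsSum {G : Type*} [AddCommMonoid G] (S : Set G) (k : ℕ) (g : G) : Prop :=
  ∃ s : Multiset G, s.card = k ∧ (∀ x ∈ s, x ∈ S) ∧ s.sum = g

namespace IsSum

variable {G : Type*} [AddCommMonoid G] {S T : Set G} {k l : ℕ} {g h : G}

lemma zero : IsSum S 0 (0 : G) := ⟨0, by simp⟩

lemma of_mem (hg : g ∈ S) : IsSum S 1 g := ⟨{g}, by simpa using hg⟩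

lemma add (hg : IsSum S k g) (hh : IsSum S l h) : IsSum S (k + l) (g + h) := by
  obtain ⟨s, rfl, hs, rfl⟩ := hg
  obtain ⟨t, rfl, ht, rfl⟩ := hh
  refine ⟨s + t, by simp, fun x hx => ?_, by simp⟩
  rcases Multiset.mem_add.1 hx with hx | hx
  exacts [hs x hx, ht x hx]

lemma subset (hST : S ⊆ T) (hg : IsSum S k g) : IsSum T k g := by
  obtain ⟨s, rfl, hs, rfl⟩ := hg
  exact ⟨s, rfl, fun x hx => hST (hs x hx), rfl⟩

lemma nsmul (hg : IsSum S k g) (n : ℕ) : IsSum S (n * k) (n • g) := by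
  induction n with
  | zero => simpa using zero
  | succ n ih => rw [add_mul, one_mul, succ_nsmul]; exact ih.add hg

lemma mono (h0 : (0 : G) ∈ S) (hkl : k ≤ l) (hg : IsSum S k g) : IsSum S l g := by
  obtain ⟨m, rfl⟩ := Nat.exists_eq_add_of_le hkl
  simpa using hg.add ((of_mem h0).nsmul m)

lemma finset_sum {ι : Type*} (t : Finset ι) {u : ι → ℕ} {c : ι → G} (hc : ∀ i ∈ t, c i ∈ S) :
    IsSum S (∑ i ∈ t, u i) (∑ i ∈ t, u i • c i) := by
  classical
  induction t using Finset.induction_on with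
  | empty => simpa using zero
  | insert i t hi ih =>
    rw [Finset.sum_insert hi, Finset.sum_insert hi]
    refine add ?_ (ih fun j hj => hc j (Finset.mem_insert_of_mem hj))
    simpa using (of_mem (hc i (Finset.mem_insert_self i t))).nsmul (u i)

lemma eq_zero (hg : IsSum S 0 g) : g = 0 := by
  obtain ⟨s, hs, -, rfl⟩ := hg
  simp [Multiset.card_eq_zero.1 hs]

/-- A sum of elements of `S ∪ -T` is a difference of a sum over `S` and a sum over `T`. -/
lemma exists_sub {G : Type*} [AddCommGroup G] {S T : Set G} {k : ℕ} {g : G}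
    (hg : IsSum (S ∪ {x | -x ∈ T}) k g) :
    ∃ p q σ τ, p + q = k ∧ IsSum S p σ ∧ IsSum T q τ ∧ g = σ - τ := by
  obtain ⟨s, rfl, hs, rfl⟩ := hg
  induction s using Multiset.induction_on with
  | empty => exact ⟨0, 0, 0, 0, by simp, zero, zero, by simp⟩
  | cons a s ih =>
    obtain ⟨p, q, σ, τ, hpq, hσ, hτ, h⟩ := ih fun x hx => hs x (Multiset.mem_cons_of_mem hx)
    rcases hs a (Multiset.mem_cons_self a s) with ha | ha
    · exact ⟨p + 1, q, σ + a, τ, by simp; omega, hσ.add (of_mem ha), hτ, by simp [h]; abel⟩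
    · exact ⟨p, q + 1, σ, τ + -a, by simp; omega, hσ, hτ.add (of_mem ha), by simp [h]; abel⟩

lemma neg {G : Type*} [AddCommGroup G] {T : Set G} {k : ℕ} {g : G} (hg : IsSum T k g) :
    IsSum {x | -x ∈ T} k (-g) := by
  obtain ⟨s, rfl, hs, rfl⟩ := hg
  refine ⟨s.map Neg.neg, by simp, fun x hx => ?_, Multiset.sum_map_neg' s⟩
  obtain ⟨y, hy, rfl⟩ := Multiset.mem_map.1 hx
  simpa using hs y hy

end IsSum

/-- If subtracting one element of `T` from one element of `S` can be normalized to a difference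
with disjoint supports, then so can subtracting a sum over `T` from a sum over `S`, without
changing the numbers of summands. -/
lemma isSum_posPart_sub {d : ℕ} {S T : Set (Fin d → ℤ)} (hS : ∀ s ∈ S, 0 ≤ s)
    (hT : ∀ t ∈ T, 0 ≤ t) (hST : ∀ s ∈ S, ∀ t ∈ T, (s - t)⁺ ∈ S ∧ (s - t)⁻ ∈ T)
    {p q : ℕ} {σ τ : Fin d → ℤ} (hσ : IsSum S p σ) (hτ : IsSum T q τ) :
    IsSum S p (σ - τ)⁺ ∧ IsSum T q (σ - τ)⁻ := by
  have hone : ∀ {p σ}, IsSum S p σ → ∀ t ∈ T, IsSum S p (σ - t)⁺ ∧ (σ - t)⁻ ∈ T := by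
    rintro p _ ⟨s, rfl, hs, rfl⟩ t ht
    induction s using Multiset.induction_on generalizing t with
    | empty =>
      have h1 : ((0 : Multiset (Fin d → ℤ)).sum - t)⁺ = 0 := by simpa using hT t ht
      have h2 : ((0 : Multiset (Fin d → ℤ)).sum - t)⁻ = t := by simpa using hT t ht
      rw [h1, h2]
      exact ⟨by simpa using IsSum.zero, ht⟩
    | cons a s ih =>
      obtain ⟨h1, h2⟩ := ih (fun x hx => hs x (Multiset.mem_cons_of_mem hx)) t ht
      have ha := hs a (Multiset.mem_cons_self a s)
      obtain ⟨h3, h4⟩ := hST a ha _ h2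
      have ha0 := hS a ha
      have e1 : ((a ::ₘ s).sum - t)⁺ = (s.sum - t)⁺ + (a - (s.sum - t)⁻)⁺ := by
        ext k
        have := ha0 k
        simp [posPart_def, negPart_def] at this ⊢
        omega
      have e2 : ((a ::ₘ s).sum - t)⁻ = (a - (s.sum - t)⁻)⁻ := by
        ext k
        have := ha0 k
        simp [negPart_def] at this ⊢
        omega
      rw [e1, e2, Multiset.card_cons]
      exact ⟨h1.add (.of_mem h3), h4⟩
  obtain ⟨t, rfl, ht, rfl⟩ := hτ
  induction t using Multiset.induction_on with
  | empty =>
    have hσ0 : 0 ≤ σ := by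
      obtain ⟨s, -, hs, rfl⟩ := hσ
      exact Multiset.sum_nonneg fun x hx => hS x (hs x hx)
    have h1 : (σ - (0 : Multiset (Fin d → ℤ)).sum)⁺ = σ := by simpa using hσ0
    have h2 : (σ - (0 : Multiset (Fin d → ℤ)).sum)⁻ = 0 := by simpa using hσ0
    rw [h1, h2]
    exact ⟨hσ, .zero⟩
  | cons a t ih =>
    obtain ⟨h1, h2⟩ := ih fun x hx => ht x (Multiset.mem_cons_of_mem hx)
    have ha := ht a (Multiset.mem_cons_self a t)
    have ha0 := hT a ha
    obtain ⟨h3, h4⟩ := hone h1 a ha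
    have e1 : (σ - (a ::ₘ t).sum)⁺ = ((σ - t.sum)⁺ - a)⁺ := by
      ext k
      have := ha0 k
      simp [posPart_def] at this ⊢
      omega
    have e2 : (σ - (a ::ₘ t).sum)⁻ = (σ - t.sum)⁻ + ((σ - t.sum)⁺ - a)⁻ := by
      ext k
      have := ha0 k
      simp [posPart_def, negPart_def] at this ⊢
      omega
    rw [e1, e2, Multiset.card_cons]
    exact ⟨h3, h2.add (.of_mem h4)⟩

/-! ### Squarefree initial ideals and lengths of representations -/

section Toric

variable {K : Type*} [Field K] {d : ℕ} {ι : Type*}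

lemma toricHom_monomial (M : Matrix (Fin d) ι ℤ) (u : ι →₀ ℕ) (c : K) :
    toricHom K M (MvPolynomial.monomial u c) =
      AddMonoidAlgebra.single (u.sum fun j e => e • M.col j, u.degree) c := by
  rw [toricHom, MvPolynomial.aeval_monomial]
  have h : (u.prod fun j e => (AddMonoidAlgebra.single (M.col j, 1) 1 : LaurentRing K d) ^ e) =
      AddMonoidAlgebra.single (u.sum fun j e => e • M.col j, u.degree) 1 := by
    simp only [AddMonoidAlgebra.single_pow, one_pow, Finsupp.prod, Finsupp.sum,
      Finsupp.degree_apply]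
    induction u.support using Finset.cons_induction with
    | empty => rfl
    | cons i s hi ih =>
      rw [Finset.prod_cons, ih, AddMonoidAlgebra.single_mul_single, Finset.sum_cons,
        Finset.sum_cons]
      simp
  rw [h]
  simp [AddMonoidAlgebra.single_mul_single]

/-- In a polynomial of the toric ideal, no monomial is alone in its fibre under `π`. -/
lemma exists_ne_of_mem_toricIdeal (M : Matrix (Fin d) ι ℤ) {f : MvPolynomial ι K}
    (hf : f ∈ toricIdeal K M) {u : ι →₀ ℕ} (hu : u ∈ f.support) :
    ∃ v ∈ f.support, v ≠ u ∧ v.degree = u.degree ∧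
      (v.sum fun j e => e • M.col j) = u.sum fun j e => e • M.col j := by
  classical
  by_contra! hcon
  have h0 : toricHom K M f = 0 := hf
  rw [f.as_sum, map_sum] at h0
  simp only [toricHom_monomial] at h0
  have h1 := DFunLike.congr_fun (congrArg AddMonoidAlgebra.coeff h0)
    (u.sum fun j e => e • M.col j, u.degree)
  simp only [AddMonoidAlgebra.coeff_sum, AddMonoidAlgebra.coeff_single,
    AddMonoidAlgebra.coeff_zero] at h1
  rw [Finsupp.finsetSum_apply, Finset.sum_eq_single u] at h1
  · rw [Finsupp.single_eq_same] at h1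
    exact MvPolynomial.mem_support_iff.1 hu h1
  · intro v hv hvu
    rw [Finsupp.single_eq_of_ne]
    intro h
    exact hcon v hv hvu (Prod.ext_iff.1 h).2.symm (Prod.ext_iff.1 h).1.symm
  · exact fun h => absurd hu h

lemma sum_nsmul_add (M : Matrix (Fin d) ι ℤ) (a b : ι →₀ ℕ) :
    ((a + b).sum fun j e => e • M.col j) =
      (a.sum fun j e => e • M.col j) + b.sum fun j e => e • M.col j :=
  Finsupp.sum_add_index' (fun _ => zero_nsmul _) (fun _ _ _ => add_nsmul _ _ _)

lemma monomial_mem_initialIdeal_iff {lt : (ι →₀ ℕ) → (ι →₀ ℕ) → Prop}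
    {I : Ideal (MvPolynomial ι K)} {u : ι →₀ ℕ} :
    MvPolynomial.monomial u 1 ∈ initialIdeal lt I ↔
      ∃ u₀ ≤ u, ∃ f ∈ I, u₀ ∈ f.support ∧ ∀ v ∈ f.support, v ≠ u₀ → lt v u₀ := by
  classical
  have h : {g | ∃ f ∈ I, ∃ u ∈ f.support,
      (∀ v ∈ f.support, v ≠ u → lt v u) ∧ g = MvPolynomial.monomial u (1 : K)} =
      (fun u => MvPolynomial.monomial u (1 : K)) ''
        {u | ∃ f ∈ I, u ∈ f.support ∧ ∀ v ∈ f.support, v ≠ u → lt v u} := by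
    ext g
    constructor
    · rintro ⟨f, hf, u, hu, hlt, rfl⟩
      exact ⟨u, ⟨f, hf, hu, hlt⟩, rfl⟩
    · rintro ⟨u, ⟨f, hf, hu, hlt⟩, rfl⟩
      exact ⟨f, hf, u, hu, hlt, rfl⟩
  rw [initialIdeal, h, MvPolynomial.mem_ideal_span_monomial_image]
  rw [MvPolynomial.support_monomial, if_neg one_ne_zero]
  simp only [Finset.mem_singleton, forall_eq, Set.mem_ofPred_eq]
  exact ⟨fun ⟨u₀, h, hle⟩ => ⟨u₀, hle, h⟩, fun ⟨u₀, hle, h⟩ => ⟨u₀, h, hle⟩⟩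

lemma IsSquarefreeMonomialIdeal.monomial_mem_of_nsmul {J : Ideal (MvPolynomial ι K)}
    (hJ : IsSquarefreeMonomialIdeal J) {u : ι →₀ ℕ} {N : ℕ}
    (h : MvPolynomial.monomial (N • u) 1 ∈ J) : MvPolynomial.monomial u 1 ∈ J := by
  classical
  obtain ⟨S, hS, rfl⟩ := hJ
  rw [MvPolynomial.mem_ideal_span_monomial_image, MvPolynomial.support_monomial,
    if_neg one_ne_zero] at h ⊢
  simp only [Finset.mem_singleton, forall_eq] at h ⊢
  obtain ⟨s, hs, hle⟩ := h
  refine ⟨s, hs, fun i => ?_⟩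
  have h1 := hle i
  have h2 := hS s hs i
  rcases Nat.eq_zero_or_pos (u i) with h0 | h0
  · simpa [h0] using h1
  · omega

lemma RevLexLT.add_right {N : ℕ} {rk : ι ≃ Fin N} {u v : ι →₀ ℕ} (h : RevLexLT rk u v)
    (w : ι →₀ ℕ) : RevLexLT rk (u + w) (v + w) := by
  rcases h with h | ⟨h, i, hj, hi⟩
  · exact Or.inl (by simpa using h)
  · exact Or.inr ⟨by simp [h], i, fun j hji => by simp [hj j hji], by simpa using hi⟩

/-- Among exponent vectors of the same degree, the reverse lexicographic order is a lexicographic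
order with reversed factors, so that finite nonempty sets have least elements. -/
lemma exists_not_revLexLT {N : ℕ} (rk : ι ≃ Fin N) {k : ℕ} {F : Set (ι →₀ ℕ)} (hF : F.Finite)
    (hne : F.Nonempty) (hdeg : ∀ u ∈ F, u.degree = k) :
    ∃ u ∈ F, ∀ v ∈ F, ¬ RevLexLT rk v u := by
  obtain ⟨u, hu, hmin⟩ := Set.exists_min_image F
    (fun u : ι →₀ ℕ => toLex fun i : Fin N => OrderDual.toDual (u (rk.symm i))) hF hne
  refine ⟨u, hu, fun v hv hlt => (hmin v hv).not_gt ?_⟩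
  rcases hlt with hlt | ⟨-, i, hj, hi⟩
  · exact absurd hlt (by rw [hdeg u hu, hdeg v hv]; exact lt_irrefl _)
  · refine ⟨rk i, fun j hji => ?_, ?_⟩
    · have := hj (rk.symm j) (by simpa using hji)
      simp [this]
    · simpa using hi

/-- Each fibre of `π` on monomials contains a standard monomial. -/
lemma exists_standard_monomial [Finite ι] {N : ℕ} (rk : ι ≃ Fin N) (M : Matrix (Fin d) ι ℤ)
    (u : ι →₀ ℕ) :
    ∃ v : ι →₀ ℕ, v.degree = u.degree ∧
      (v.sum fun j e => e • M.col j) = (u.sum fun j e => e • M.col j) ∧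
      MvPolynomial.monomial v (1 : K) ∉ initialIdeal (RevLexLT rk) (toricIdeal K M) := by
  obtain ⟨v, ⟨hv1, hv2⟩, hmin⟩ := exists_not_revLexLT rk
    (F := {v : ι →₀ ℕ | v.degree = u.degree ∧
      (v.sum fun j e => e • M.col j) = (u.sum fun j e => e • M.col j)})
    ((Finsupp.finite_of_degree_eq u.degree).subset fun v hv => hv.1) ⟨u, rfl, rfl⟩
    fun v hv => hv.1
  refine ⟨v, hv1, hv2, fun hmem => ?_⟩
  obtain ⟨u₀, hle, f, hf, hu₀, hlt⟩ := monomial_mem_initialIdeal_iff.1 hmem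
  obtain ⟨w, hw, hne, hdeg, hwt⟩ := exists_ne_of_mem_toricIdeal M hf hu₀
  obtain ⟨t, rfl⟩ := le_iff_exists_add.1 hle
  -- The monomial of `w` lies in the fibre of the initial monomial and is smaller.
  refine hmin (w + t) ⟨?_, ?_⟩ ((hlt w hw hne).add_right t)
  · rw [← hv1, map_add, map_add, hdeg]
  · rw [← hv2, sum_nsmul_add, sum_nsmul_add, hwt]

lemma isSum_range_col_iff (M : Matrix (Fin d) ι ℤ) {k : ℕ} {α : Fin d → ℤ} :
    IsSum (Set.range M.col) k α ↔
      ∃ u : ι →₀ ℕ, u.degree = k ∧ (u.sum fun j e => e • M.col j) = α := by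
  classical
  constructor
  · rintro ⟨s, rfl, hs, rfl⟩
    induction s using Multiset.induction_on with
    | empty => exact ⟨0, by simp, by simp⟩
    | cons a s ih =>
      obtain ⟨u, hu1, hu2⟩ := ih fun x hx => hs x (Multiset.mem_cons_of_mem hx)
      obtain ⟨j, rfl⟩ := hs a (Multiset.mem_cons_self a s)
      refine ⟨Finsupp.single j 1 + u, by simp [hu1, add_comm], ?_⟩
      rw [sum_nsmul_add, hu2, Finsupp.sum_single_index (by simp)]
      simp
  · rintro ⟨u, rfl, rfl⟩
    exact IsSum.finset_sum _ fun j _ => Set.mem_range_self j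

/-- The least number of columns of `M` that add up to `α` is homogeneous in `α`. Indeed, the
standard monomial `x ^ u` of the fibre of `α` in this least degree is not divisible by `z`, and all
its powers are standard since the initial ideal is squarefree. A representation of `N • α` by fewer
than `N * u.degree` columns would, filled up by a power of the smallest variable `z`, show that
`x ^ (N • u)` is an initial monomial. -/
lemma exists_isSum_of_nsmul {n : ℕ} (M : Matrix (Fin d) (Fin n) ℤ)
    (rk : Option (Fin n) ≃ Fin (n + 1)) (hz : ∀ i, rk none < rk (some i))
    (hsq : IsSquarefreeMonomialIdeal
      (initialIdeal (RevLexLT rk) (toricIdeal K (sharp M))))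
    {α : Fin d → ℤ} {k₀ N l : ℕ} (hα : IsSum (Set.range (sharp M).col) k₀ α)
    (hl : IsSum (Set.range (sharp M).col) l (N • α)) :
    ∃ k, N * k ≤ l ∧ IsSum (Set.range (sharp M).col) k α := by
  classical
  have hex : ∃ k, IsSum (Set.range (sharp M).col) k α := ⟨k₀, hα⟩
  have hk := Nat.find_spec hex
  have hkmin : ∀ k, IsSum (Set.range (sharp M).col) k α → Nat.find hex ≤ k :=
    fun k h => Nat.find_min' hex h
  generalize Nat.find hex = k at hk hkmin
  refine ⟨k, ?_, hk⟩
  by_contra! hlt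
  obtain ⟨u₀, rfl, hu₀⟩ := (isSum_range_col_iff _).1 hk
  obtain ⟨u, hdeg, hwt, hstd⟩ := exists_standard_monomial (K := K) rk (sharp M) u₀
  rw [hu₀] at hwt
  rw [← hdeg] at hkmin hlt
  have hz0 : (sharp M).col none = 0 := rfl
  have hsingle : ∀ e : ℕ, ((Finsupp.single none e : Option (Fin n) →₀ ℕ).sum
      fun j e => e • (sharp M).col j) = 0 := fun e => by
    rw [Finsupp.sum_single_index (by simp), hz0, smul_zero]
  have hu : u none = 0 := by
    by_contra hne
    have hle : Finsupp.single none 1 ≤ u := by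
      rw [Finsupp.single_le_iff]
      omega
    obtain ⟨t, rfl⟩ := le_iff_exists_add.1 hle
    rw [sum_nsmul_add, hsingle, zero_add] at hwt
    have := hkmin t.degree ((isSum_range_col_iff _).2 ⟨t, rfl, hwt⟩)
    simp at this
  obtain ⟨w, rfl, hw⟩ := (isSum_range_col_iff _).1 hl
  obtain ⟨e, he⟩ := Nat.exists_eq_add_of_le hlt.le
  have he0 : 0 < e := by omega
  refine hstd (hsq.monomial_mem_of_nsmul (N := N) (monomial_mem_initialIdeal_iff.2
    ⟨N • u, le_rfl, MvPolynomial.monomial (N • u) 1 - MvPolynomial.monomial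
      (w + Finsupp.single none e) 1, ?_, ?_, ?_⟩))
  · have hN : ((N • u).sum fun j e => e • (sharp M).col j) = N • α := by
      rw [Finsupp.sum_smul_index (by simp), ← hwt, Finsupp.smul_sum]
      simp only [mul_nsmul']
    rw [toricIdeal, RingHom.mem_ker, map_sub, toricHom_monomial, toricHom_monomial, hN,
      sum_nsmul_add, hsingle, add_zero, hw, map_add, Finsupp.degree_single, map_nsmul,
      smul_eq_mul, he, sub_self]
  · have hne : w + Finsupp.single none e ≠ N • u := fun h => by
      have := DFunLike.congr_fun h none
      simp [hu] at this
      omega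
    simp [MvPolynomial.coeff_monomial, hne]
  · intro v hv hne
    have hv' : v = w + Finsupp.single none e := by
      by_contra h
      simp [MvPolynomial.coeff_monomial, Ne.symm hne, Ne.symm h] at hv
    subst hv'
    refine Or.inr ⟨?_, none, fun j hj => ?_, ?_⟩
    · rw [map_add, Finsupp.degree_single, map_nsmul, smul_eq_mul, he]
    · cases j with
      | none => exact absurd hj (lt_irrefl _)
      | some i => exact absurd hj (hz i).not_gt
    · simp [hu]
      omega

end Toric

/-! ### Harmony forces entries at most one -/

/-- A set of nonnegative vectors in harmony with a set generating the nonnegative orthant is closed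
under passing to smaller nonnegative vectors. If the number of summands is also homogeneous, then no
entry exceeds `1`: otherwise `2 e_k` would belong to `S`, and `e_k` would be a sum of `0`
elements. -/
lemma apply_le_one_of_harmony {d : ℕ} {S T : Set (Fin d → ℤ)} (hS : ∀ s ∈ S, 0 ≤ s)
    (hT : ∀ t ∈ T, 0 ≤ t) (hST : ∀ s ∈ S, ∀ t ∈ T, (s - t)⁺ ∈ S ∧ (s - t)⁻ ∈ T)
    (hgen : ∀ α : Fin d → ℤ, 0 ≤ α → ∃ q, IsSum T q α)
    (hhom : ∀ (α : Fin d → ℤ) (N l : ℕ), 0 ≤ α → IsSum S l (N • α) →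
      ∃ k, N * k ≤ l ∧ IsSum S k α)
    {s : Fin d → ℤ} (hs : s ∈ S) (k : Fin d) : s k ≤ 1 := by
  by_contra! hlt
  have he0 : (0 : Fin d → ℤ) ≤ Pi.single k 1 := Pi.single_nonneg.2 zero_le_one
  have hle : (2 : ℕ) • (Pi.single k 1 : Fin d → ℤ) ≤ s := by
    intro j
    rcases eq_or_ne j k with rfl | hj
    · simp
      omega
    · simpa [hj] using hS s hs j
  obtain ⟨q, hq⟩ := hgen (s - (2 : ℕ) • Pi.single k 1) (sub_nonneg.2 hle)
  have h1 := (isSum_posPart_sub hS hT hST (.of_mem hs) hq).1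
  rw [sub_sub_cancel, posPart_of_nonneg (nsmul_nonneg he0 2)] at h1
  obtain ⟨j, hj, hsum⟩ := hhom _ 2 1 he0 h1
  obtain rfl : j = 0 := by omega
  simpa using congrFun hsum.eq_zero k

/-! ### Representations with real coefficients -/

section Real

variable {d : ℕ} {ι : Type*} [Fintype ι]

lemma mem_columnPolytope_iff {M : Matrix (Fin d) ι ℤ} {y : Fin d → ℝ} :
    y ∈ columnPolytope M ↔ ∃ w : ι → ℝ, (∀ i, 0 ≤ w i) ∧ ∑ i, w i = 1 ∧
      ∀ k, y k = ∑ i, w i * M k i := by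
  classical
  constructor
  · intro hy
    let C : Set (Fin d → ℝ) := {y | ∃ w : ι → ℝ, (∀ i, 0 ≤ w i) ∧ ∑ i, w i = 1 ∧
      ∀ k, y k = ∑ i, w i * M k i}
    have hC : Convex ℝ C := by
      rintro y ⟨w, hw0, hw1, hw⟩ y' ⟨w', hw0', hw1', hw'⟩ a b ha hb hab
      refine ⟨fun i => a * w i + b * w' i, fun i => ?_, ?_, fun k => ?_⟩
      · have := hw0 i
        have := hw0' i
        positivity
      · rw [Finset.sum_add_distrib, ← Finset.mul_sum, ← Finset.mul_sum, hw1, hw1']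
        simpa using hab
      · simp only [Pi.add_apply, Pi.smul_apply, smul_eq_mul, hw k, hw' k, Finset.mul_sum, add_mul,
          Finset.sum_add_distrib, mul_assoc]
    refine convexHull_min (t := C) ?_ hC hy
    rintro _ ⟨j, rfl⟩
    refine ⟨fun i => if i = j then 1 else 0, fun i => ?_, by simp, fun k => by simp⟩
    dsimp only
    split_ifs <;> simp
  · rintro ⟨w, hw0, hw1, hw⟩
    have : y = ∑ i, w i • fun k => (M k i : ℝ) := by
      ext k
      simp [hw k, Finset.sum_apply]
    rw [this]
    exact (convex_convexHull ℝ _).sum_mem (fun i _ => hw0 i) hw1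
      fun i _ => subset_convexHull ℝ _ ⟨i, rfl⟩

lemma exists_pos_add_smul_mem {P : Set (Fin d → ℝ)} {x : Fin d → ℝ} (hx : x ∈ interior P)
    (v : Fin d → ℝ) : ∃ ε : ℝ, 0 < ε ∧ x + ε • v ∈ P := by
  have h : Filter.Tendsto (fun ε : ℝ => x + ε • v) (nhds 0) (nhds x) := by
    have : Continuous fun ε : ℝ => x + ε • v := by fun_prop
    simpa using this.tendsto 0
  have h2 := (h.eventually (mem_interior_iff_mem_nhds.1 hx)).filter_mono
    (nhdsWithin_le_nhds (s := Set.Ioi 0))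
  obtain ⟨ε, h3, h4⟩ := (h2.and self_mem_nhdsWithin).exists
  exact ⟨ε, h4, h3⟩

/-- Rounding down the coefficients of a real combination of integer columns changes it by a vector
of a fixed finite box. -/
lemma sub_sum_floor_mem_Icc (M : Matrix (Fin d) ι ℤ) {g : Fin d → ℤ} {ν : ι → ℝ}
    (hg : ∀ k, (g k : ℝ) = ∑ i, ν i * M k i) :
    g - ∑ i, ⌊ν i⌋ • M.col i ∈
      Set.Icc (-fun k => ∑ i, |M k i|) (fun k => ∑ i, |M k i|) := by
  have key : ∀ k, |(g - ∑ i, ⌊ν i⌋ • M.col i) k| ≤ ∑ i, |M k i| := by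
    intro k
    have h1 : (((g - ∑ i, ⌊ν i⌋ • M.col i) k : ℤ) : ℝ) = ∑ i, Int.fract (ν i) * M k i := by
      simp [Finset.sum_apply, hg k, ← Finset.sum_sub_distrib, ← sub_mul]
    have h2 : |∑ i, Int.fract (ν i) * (M k i : ℝ)| ≤ ∑ i, |(M k i : ℝ)| := by
      refine (Finset.abs_sum_le_sum_abs _ _).trans (Finset.sum_le_sum fun i _ => ?_)
      rw [abs_mul, Int.abs_fract]
      exact mul_le_of_le_one_left (abs_nonneg _) (Int.fract_lt_one _).le
    rw [← h1] at h2
    exact_mod_cast h2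
  exact ⟨fun k => (abs_le.1 (key k)).1, fun k => (abs_le.1 (key k)).2⟩

/-- If the origin is interior to the polytope, then the columns satisfy a relation with positive
integer coefficients. -/
lemma exists_pos_relation {M : Matrix (Fin d) ι ℤ} (hint : 0 ∈ interior (columnPolytope M)) :
    ∃ k : ι → ℕ, (∀ i, 0 < k i) ∧ ∑ i, k i • M.col i = 0 := by
  obtain ⟨ε, hε, hmem⟩ := exists_pos_add_smul_mem hint (-∑ i, fun k => (M k i : ℝ))
  obtain ⟨w, hw0, -, hw⟩ := mem_columnPolytope_iff.1 hmem
  -- The real relation with coefficients `(w i + ε) / ε ≥ 1`.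
  obtain ⟨μ, hrel, hμ⟩ : ∃ μ : ι → ℝ, (∀ k, ∑ i, μ i * (M k i : ℝ) = 0) ∧ ∀ i, 1 ≤ μ i := by
    refine ⟨fun i => w i / ε + 1, fun k => ?_, fun i => ?_⟩
    · have h := hw k
      simp only [Pi.add_apply, Pi.zero_apply, Pi.smul_apply, Pi.neg_apply, Finset.sum_apply,
        smul_eq_mul, zero_add] at h
      simp only [add_mul, one_mul, Finset.sum_add_distrib, div_mul_eq_mul_div, ← Finset.sum_div,
        ← h]
      field_simp
      simp
    · have := hw0 i
      have : 0 ≤ w i / ε := by positivity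
      linarith
  -- Two of the rounded multiples of the relation have the same error; subtract them.
  let f : ℕ → Set.Icc (-fun k => ∑ i, |M k i|) (fun k => ∑ i, |M k i|) := fun N =>
    ⟨0 - ∑ i, ⌊(N : ℝ) * μ i⌋ • M.col i, sub_sum_floor_mem_Icc M fun k => by
      simp [mul_assoc, ← Finset.mul_sum, hrel k]⟩
  obtain ⟨N, N', hne, heq⟩ := Finite.exists_ne_map_eq_of_infinite f
  wlog hlt : N < N' generalizing N N'
  · exact this N' N hne.symm heq.symm (lt_of_le_of_ne (not_lt.1 hlt) hne.symm)
  have hfl : ∀ i, ⌊(N : ℝ) * μ i⌋ < ⌊(N' : ℝ) * μ i⌋ := fun i => by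
    have h1 : (N : ℝ) + 1 ≤ N' := by exact_mod_cast hlt
    have h2 : ⌊(N : ℝ) * μ i⌋ + 1 ≤ ⌊(N' : ℝ) * μ i⌋ := by
      rw [Int.le_floor]
      push_cast
      nlinarith [Int.floor_le ((N : ℝ) * μ i), hμ i]
    omega
  refine ⟨fun i => (⌊(N' : ℝ) * μ i⌋ - ⌊(N : ℝ) * μ i⌋).toNat, fun i => ?_, ?_⟩
  · have := hfl i
    dsimp only
    omega
  · have h1 : ∀ i, (⌊(N' : ℝ) * μ i⌋ - ⌊(N : ℝ) * μ i⌋).toNat • M.col i =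
        ⌊(N' : ℝ) * μ i⌋ • M.col i - ⌊(N : ℝ) * μ i⌋ • M.col i := fun i => by
      rw [← sub_smul, ← natCast_zsmul, Int.toNat_of_nonneg (sub_nonneg.2 (hfl i).le)]
    have h2 : ∑ i, ⌊(N : ℝ) * μ i⌋ • M.col i = ∑ i, ⌊(N' : ℝ) * μ i⌋ • M.col i := by
      simpa [f] using congrArg Subtype.val heq
    simp only [h1, Finset.sum_sub_distrib, h2, sub_self]

/-- If the origin is interior to the polytope and some maximal minor is `±1`, then the columns
generate `ℤᵈ` as a monoid. -/
lemma exists_eq_sum_nsmul_col {M : Matrix (Fin d) ι ℤ} (hint : 0 ∈ interior (columnPolytope M))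
    (hminor : ∃ f : Fin d → ι, (M.submatrix id f).det = 1 ∨ (M.submatrix id f).det = -1)
    (γ : Fin d → ℤ) : ∃ u : ι → ℕ, γ = ∑ i, u i • M.col i := by
  classical
  obtain ⟨f, hf⟩ := hminor
  obtain ⟨k, hk, hrel⟩ := exists_pos_relation hint
  have hdet : IsUnit (M.submatrix id f).det := Int.isUnit_iff.2 hf
  -- Integer coefficients, from the unimodular minor.
  obtain ⟨z, hz⟩ : ∃ z : ι → ℤ, γ = ∑ i, z i • M.col i := by
    refine ⟨fun i => ∑ j, if f j = i then ((M.submatrix id f)⁻¹ *ᵥ γ) j else 0, ?_⟩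
    have h : M.submatrix id f *ᵥ ((M.submatrix id f)⁻¹ *ᵥ γ) = γ := by
      rw [Matrix.mulVec_mulVec, Matrix.mul_nonsing_inv _ hdet, Matrix.one_mulVec]
    generalize (M.submatrix id f)⁻¹ *ᵥ γ = y at h
    rw [← h]
    simp only [Finset.sum_smul]
    rw [Finset.sum_comm]
    ext k
    simp [Matrix.mulVec, dotProduct, Finset.sum_apply, mul_comm]
  -- Adding a multiple of the positive relation makes them nonnegative.
  refine ⟨fun i => (z i + (∑ j, |z j|) * k i).toNat, ?_⟩
  have hnn : ∀ i, 0 ≤ z i + (∑ j, |z j|) * k i := fun i => by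
    have h1 : |z i| ≤ ∑ j, |z j| :=
      Finset.single_le_sum (fun j _ => abs_nonneg (z j)) (Finset.mem_univ i)
    have h2 : (1 : ℤ) ≤ k i := by exact_mod_cast hk i
    nlinarith [neg_abs_le (z i), abs_nonneg (z i)]
  have h1 : ∀ i, (z i + (∑ j, |z j|) * k i).toNat • M.col i =
      z i • M.col i + (∑ j, |z j|) • k i • M.col i := fun i => by
    rw [← natCast_zsmul, Int.toNat_of_nonneg (hnn i), add_smul, mul_smul, natCast_zsmul]
  simp only [h1, Finset.sum_add_distrib, ← Finset.smul_sum, hrel, smul_zero, add_zero]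
  exact hz

/-- Every integer point that is a combination of the columns of `M` with nonnegative real
coefficients `c` is a sum of at most `∑ i, c i` columns. -/
def HasIntegerDecomposition (M : Matrix (Fin d) ι ℤ) : Prop :=
  ∀ (γ : Fin d → ℤ) (c : ι → ℝ), (∀ i, 0 ≤ c i) → (∀ k, (γ k : ℝ) = ∑ i, c i * M k i) →
    ∃ k : ℕ, (k : ℝ) ≤ ∑ i, c i ∧ IsSum (insert 0 (Set.range M.col)) k γ

/-- For large `N`, rounding down the coefficients of `N • γ` costs a bounded number of summands.
Dividing by `N`, which homogeneity permits, makes this error disappear. -/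
lemma hasIntegerDecomposition_of_homogeneous {M : Matrix (Fin d) ι ℤ}
    (hgen : ∀ γ, ∃ k, IsSum (insert 0 (Set.range M.col)) k γ)
    (hhom : ∀ (γ : Fin d → ℤ) (N l : ℕ), IsSum (insert 0 (Set.range M.col)) l (N • γ) →
      ∃ k, N * k ≤ l ∧ IsSum (insert 0 (Set.range M.col)) k γ) :
    HasIntegerDecomposition M := by
  intro γ c hc hγ
  choose κ hκ using hgen
  set R := (Finset.Icc (-fun k => ∑ i, |M k i|) (fun k => ∑ i, |M k i|)).sup κ with hR
  have hc0 : 0 ≤ ∑ i, c i := Finset.sum_nonneg fun i _ => hc i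
  -- `N` is so large that `∑ i, c i + R / N` has the same integral part as `∑ i, c i`.
  obtain ⟨N, hN⟩ := exists_nat_gt (R / (⌊∑ i, c i⌋₊ + 1 - ∑ i, c i))
  have hpos : 0 < (⌊∑ i, c i⌋₊ + 1 - ∑ i, c i : ℝ) := sub_pos.2 (Nat.lt_floor_add_one _)
  rw [div_lt_iff₀ hpos] at hN
  have hrest := sub_sum_floor_mem_Icc M (g := N • γ) (ν := fun i => N * c i) fun k => by
    simp [mul_assoc, ← Finset.mul_sum, hγ k]
  set ρ := N • γ - ∑ i, ⌊(N : ℝ) * c i⌋ • M.col i with hρ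
  have h1 : IsSum (insert 0 (Set.range M.col)) R ρ :=
    (hκ ρ).mono (Set.mem_insert _ _) (Finset.le_sup (Finset.mem_Icc.2 hrest))
  have h2 : IsSum (insert 0 (Set.range M.col)) (∑ i, ⌊(N : ℝ) * c i⌋₊)
      (∑ i, ⌊(N : ℝ) * c i⌋₊ • M.col i) :=
    IsSum.finset_sum _ fun i _ => Set.mem_insert_of_mem _ (Set.mem_range_self i)
  have h3 : ∑ i, ⌊(N : ℝ) * c i⌋₊ • M.col i + ρ = N • γ := by
    have h : ∀ i, ⌊(N : ℝ) * c i⌋₊ • M.col i = ⌊(N : ℝ) * c i⌋ • M.col i := fun i => by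
      have := hc i
      rw [← natCast_zsmul, Int.natCast_floor_eq_floor (by positivity)]
    simp only [hρ, h]
    abel
  obtain ⟨k, hk, hsum⟩ := hhom γ N _ (h3 ▸ h2.add h1)
  refine ⟨k, ?_, hsum⟩
  have h4 : ((∑ i, ⌊(N : ℝ) * c i⌋₊ : ℕ) : ℝ) ≤ N * ∑ i, c i := by
    push_cast
    rw [Finset.mul_sum]
    refine Finset.sum_le_sum fun i _ => Nat.floor_le ?_
    have := hc i
    positivity
  have h5 : (N * k : ℝ) ≤ (∑ i, ⌊(N : ℝ) * c i⌋₊ : ℕ) + R := by exact_mod_cast hk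
  have h6 : (k : ℝ) < ⌊∑ i, c i⌋₊ + 1 := by
    by_contra! h
    have : (N : ℝ) * (⌊∑ i, c i⌋₊ + 1) ≤ N * k := by gcongr
    nlinarith
  have h7 : k ≤ ⌊∑ i, c i⌋₊ := by
    have : k < ⌊∑ i, c i⌋₊ + 1 := by exact_mod_cast h6
    omega
  exact (Nat.cast_le.2 h7).trans (Nat.floor_le hc0)

end Real

/-! ### Lattice points and supporting hyperplanes -/

section Polytope

variable {d : ℕ}

/-- The inclusion of `ℤᵈ` into `ℝᵈ`. -/
def castVec : (Fin d → ℤ) →ₗ[ℤ] (Fin d → ℝ) :=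
  (Int.castAddHom ℝ).toIntLinearMap.compLeft (Fin d)

@[simp]
lemma castVec_apply (z : Fin d → ℤ) (k : Fin d) : castVec z k = z k := rfl

lemma castVec_injective : Function.Injective (castVec (d := d)) := fun y z h => by
  ext k
  have := congrFun h k
  simpa using this

lemma dotProduct_castVec_sum_le {x : Fin d → ℝ} {s : Multiset (Fin d → ℤ)}
    (h : ∀ c ∈ s, x ⬝ᵥ castVec c ≤ 1) : x ⬝ᵥ castVec s.sum ≤ s.card := by
  induction s using Multiset.induction_on with
  | empty => simp
  | cons a s ih =>
    have h1 := ih fun c hc => h c (Multiset.mem_cons_of_mem hc)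
    have h2 := h a (Multiset.mem_cons_self a s)
    rw [Multiset.sum_cons, map_add, dotProduct_add, Multiset.card_cons]
    push_cast
    linarith

lemma dotProduct_castVec_eq_one {x : Fin d → ℝ} {s : Multiset (Fin d → ℤ)}
    (h : ∀ c ∈ s, x ⬝ᵥ castVec c ≤ 1) (hs : (s.card : ℝ) ≤ x ⬝ᵥ castVec s.sum) :
    ∀ c ∈ s, x ⬝ᵥ castVec c = 1 := by
  intro c hc
  obtain ⟨t, rfl⟩ := Multiset.exists_cons_of_mem hc
  have h1 := dotProduct_castVec_sum_le fun c hc => h c (Multiset.mem_cons_of_mem hc)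
  rw [Multiset.sum_cons, map_add, dotProduct_add, Multiset.card_cons] at hs
  push_cast at hs
  linarith [h c hc]

variable {ι : Type*} {M : Matrix (Fin d) ι ℤ}

lemma castVec_col_mem (i : ι) : castVec (M.col i) ∈ columnPolytope M :=
  subset_convexHull ℝ _ ⟨i, rfl⟩

lemma extremePoints_columnPolytope_subset :
    (columnPolytope M).extremePoints ℝ ⊆ Set.range fun i => castVec (M.col i) :=
  extremePoints_convexHull_subset

lemma dimension_columnPolytope (hint : 0 ∈ interior (columnPolytope M)) :
    dimension (columnPolytope M) = d := by
  have h := affineSpan_eq_top_of_nonempty_interior ⟨0, hint⟩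
  rw [dimension, ← direction_affineSpan, columnPolytope, affineSpan_convexHull, h,
    AffineSubspace.direction_top, finrank_top, Module.finrank_fin_fun]

lemma mem_dualPolytope_columnPolytope {x : Fin d → ℝ} :
    x ∈ dualPolytope (columnPolytope M) ↔ ∀ i, x ⬝ᵥ castVec (M.col i) ≤ 1 := by
  refine ⟨fun h i => h _ (castVec_col_mem i), fun h y hy => ?_⟩
  have hconv : Convex ℝ {y : Fin d → ℝ | x ⬝ᵥ y ≤ 1} :=
    convex_halfSpace_le (f := fun y => x ⬝ᵥ y)
      ⟨dotProduct_add x, fun c y => dotProduct_smul c x y⟩ 1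
  refine convexHull_min ?_ hconv hy
  rintro _ ⟨i, rfl⟩
  exact h i

variable [Fintype ι]

/-- If the columns on a supporting hyperplane `⟨x, ·⟩ = 1` span `ℝᵈ`, then they generate `ℤᵈ`.
An integer vector deep inside the cone over these columns is a sum of at most `⟨x, γ⟩` columns, and
these must all lie on the hyperplane. -/
lemma mem_span_tight_columns (hdec : HasIntegerDecomposition M) {x : Fin d → ℝ}
    (hx : ∀ i, x ⬝ᵥ castVec (M.col i) ≤ 1)
    (hspan : Submodule.span ℝ
      (Set.range fun i : {i | x ⬝ᵥ castVec (M.col i) = 1} => castVec (M.col i)) = ⊤)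
    (γ : Fin d → ℤ) :
    γ ∈ Submodule.span ℤ (M.col '' {i | x ⬝ᵥ castVec (M.col i) = 1}) := by
  classical
  have hγ : castVec γ ∈ Submodule.span ℝ
      (Set.range fun i : {i | x ⬝ᵥ castVec (M.col i) = 1} => castVec (M.col i)) :=
    hspan ▸ Submodule.mem_top
  obtain ⟨μ, hμ⟩ := (Submodule.mem_span_range_iff_exists_fun ℝ).1 hγ
  obtain ⟨N, hN⟩ := exists_nat_ge (∑ i, |μ i|)
  have hμN : ∀ i, 0 ≤ μ i + N := fun i => by
    have : |μ i| ≤ ∑ i, |μ i| :=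
      Finset.single_le_sum (fun j _ => abs_nonneg (μ j)) (Finset.mem_univ i)
    linarith [neg_abs_le (μ i)]
  set β := γ + N • ∑ i : {i | x ⬝ᵥ castVec (M.col i) = 1}, M.col i with hβ
  have hβcast : castVec β =
      ∑ i : {i | x ⬝ᵥ castVec (M.col i) = 1}, (μ i + N) • castVec (M.col i) := by
    simp only [hβ, map_add, map_nsmul, map_sum, ← hμ, add_smul, Finset.sum_add_distrib,
      Finset.smul_sum, Nat.cast_smul_eq_nsmul]
  let c : ι → ℝ := fun i => if h : x ⬝ᵥ castVec (M.col i) = 1 then μ ⟨i, h⟩ + N else 0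
  have hsub : ∀ f : ι → ℝ, ∑ i, c i * f i =
      ∑ i : {i | x ⬝ᵥ castVec (M.col i) = 1}, (μ i + N) * f i := fun f => by
    symm
    calc _ = ∑ i : {i // x ⬝ᵥ castVec (M.col i) = 1}, c i * f i :=
          Finset.sum_congr rfl fun i _ => by
            have h : x ⬝ᵥ castVec (M.col i) = 1 := i.2
            simp only [c, dif_pos h]
            rfl
      _ = ∑ i with x ⬝ᵥ castVec (M.col i) = 1, c i * f i :=
          (Finset.sum_subtype _ (by simp) fun i => c i * f i).symm
      _ = _ := Finset.sum_filter_of_ne fun i _ hi => by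
          by_contra h
          simp [c, h] at hi
  obtain ⟨k, hk, s, rfl, hs, hsum⟩ := hdec β c
    (fun i => by
      dsimp only [c]
      split_ifs with h
      exacts [hμN ⟨i, h⟩, le_rfl])
    fun k => by
      rw [hsub, ← castVec_apply, hβcast]
      simp [Finset.sum_apply]
  have hdot : x ⬝ᵥ castVec β = ∑ i, c i := by
    have h := hsub fun _ => 1
    simp only [mul_one] at h
    rw [h, hβcast, dotProduct_sum]
    refine Finset.sum_congr rfl fun i _ => ?_
    rw [dotProduct_smul, i.2, smul_eq_mul, mul_one]
  have hle : ∀ c ∈ s, x ⬝ᵥ castVec c ≤ 1 := fun c hc => by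
    rcases hs c hc with rfl | ⟨i, rfl⟩
    exacts [by simp, hx i]
  have htight := dotProduct_castVec_eq_one hle (by rw [hsum, hdot]; exact hk)
  have hβmem : β ∈ Submodule.span ℤ (M.col '' {i | x ⬝ᵥ castVec (M.col i) = 1}) := by
    rw [← hsum]
    refine multiset_sum_mem _ fun c hc => ?_
    have h1 := htight c hc
    rcases hs c hc with rfl | ⟨i, rfl⟩
    · simp at h1
    · exact Submodule.subset_span ⟨i, h1, rfl⟩
  have hmem : N • ∑ i : {i | x ⬝ᵥ castVec (M.col i) = 1}, M.col i ∈
      Submodule.span ℤ (M.col '' {i | x ⬝ᵥ castVec (M.col i) = 1}) :=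
    Submodule.smul_of_tower_mem _ N (Submodule.sum_mem _ fun i _ =>
      Submodule.subset_span ⟨i, i.2, rfl⟩)
  have := Submodule.sub_mem _ hβmem hmem
  rwa [hβ, add_sub_cancel_right] at this

/-! ### The dual polytope -/

lemma isCompact_columnPolytope : IsCompact (columnPolytope M) :=
  (Set.finite_range _).isCompact_convexHull ℝ

lemma isIntegralPolytope_columnPolytope : IsIntegralPolytope (columnPolytope M) := by
  refine ⟨⟨_, Set.finite_range _, rfl⟩, fun v hv => ?_⟩
  obtain ⟨i, rfl⟩ := extremePoints_columnPolytope_subset hv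
  exact ⟨M.col i, rfl⟩

lemma convex_dualPolytope (P : Set (Fin d → ℝ)) : Convex ℝ (dualPolytope P) := by
  intro x hx x' hx' a b ha hb hab y hy
  rw [add_dotProduct, smul_dotProduct, smul_dotProduct, smul_eq_mul, smul_eq_mul]
  nlinarith [hx y hy, hx' y hy]

lemma isClosed_dualPolytope (P : Set (Fin d → ℝ)) : IsClosed (dualPolytope P) := by
  have : dualPolytope P = ⋂ y ∈ P, {x | x ⬝ᵥ y ≤ 1} := by
    ext x
    simp [dualPolytope]
  rw [this]
  refine isClosed_biInter fun y _ => isClosed_le ?_ continuous_const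
  simp only [dotProduct]
  fun_prop

lemma exists_dualPolytope_subset_Icc {P : Set (Fin d → ℝ)} (hP : 0 ∈ interior P) :
    ∃ a b, dualPolytope P ⊆ Set.Icc a b := by
  choose ε hε hmem using fun k => exists_pos_add_smul_mem hP (Pi.single k 1)
  choose δ hδ hmem' using fun k => exists_pos_add_smul_mem hP (-Pi.single k 1)
  refine ⟨fun k => -(δ k)⁻¹, fun k => (ε k)⁻¹, fun x hx => ⟨fun k => ?_, fun k => ?_⟩⟩
  · have h := hx _ (hmem' k)
    rw [zero_add, dotProduct_smul, dotProduct_neg, dotProduct_single, mul_one, smul_eq_mul] at h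
    dsimp only
    rw [neg_le, ← one_div, le_div_iff₀ (hδ k)]
    linarith
  · have h := hx _ (hmem k)
    rw [zero_add, dotProduct_smul, dotProduct_single, mul_one, smul_eq_mul] at h
    dsimp only
    rw [← one_div, le_div_iff₀ (hε k)]
    linarith

lemma finite_integerPoints_inter {Q : Set (Fin d → ℝ)} {a b : Fin d → ℝ} (hQ : Q ⊆ Set.Icc a b) :
    {x ∈ Q | IsIntegerPoint x}.Finite := by
  refine ((Set.finite_Icc (fun k => ⌈a k⌉) (fun k => ⌊b k⌋)).image castVec).subset ?_
  rintro _ ⟨hx, z, rfl⟩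
  have h := hQ hx
  exact ⟨z, ⟨fun k => Int.ceil_le.2 (h.1 k), fun k => Int.le_floor.2 (h.2 k)⟩, rfl⟩

/-- The columns on which a vertex of the dual polytope takes the value `1` span the space. -/
lemma span_tight_columns_eq_top {x : Fin d → ℝ}
    (hx : x ∈ (dualPolytope (columnPolytope M)).extremePoints ℝ) :
    Submodule.span ℝ
      (Set.range fun i : {i | x ⬝ᵥ castVec (M.col i) = 1} => castVec (M.col i)) = ⊤ := by
  classical
  by_contra hne
  obtain ⟨f, hf, hker⟩ := Submodule.exists_le_ker_of_lt_top _ (lt_top_iff_ne_top.2 hne)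
  -- Otherwise a vector `w` is orthogonal to all these columns, and `x` can be moved along `w`.
  obtain ⟨w, hw⟩ : ∃ w : Fin d → ℝ, ∀ y, f y = w ⬝ᵥ y :=
    ⟨fun k => f (Pi.single k 1), fun y => by
      conv_lhs => rw [pi_eq_sum_univ' y]
      simp [dotProduct, mul_comm]⟩
  have hw0 : w ≠ 0 := fun h => hf (LinearMap.ext fun y => by simp [hw, h])
  have hdual := mem_dualPolytope_columnPolytope.1 hx.1
  have horth : ∀ i, x ⬝ᵥ castVec (M.col i) = 1 → w ⬝ᵥ castVec (M.col i) = 0 := fun i hi => by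
    rw [← hw]
    exact hker (Submodule.subset_span ⟨⟨i, hi⟩, rfl⟩)
  have hev : ∀ i, ∀ᶠ ε : ℝ in nhds 0, (x + ε • w) ⬝ᵥ castVec (M.col i) ≤ 1 ∧
      (x - ε • w) ⬝ᵥ castVec (M.col i) ≤ 1 := fun i => by
    rcases (hdual i).eq_or_lt with h | h
    · refine Filter.Eventually.of_forall fun ε => ?_
      simp [add_dotProduct, sub_dotProduct, smul_dotProduct, horth i h, h]
    · have h1 : Continuous fun ε : ℝ => (x + ε • w) ⬝ᵥ castVec (M.col i) := by
        simp only [dotProduct, Pi.add_apply, Pi.smul_apply]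
        fun_prop
      have h2 : Continuous fun ε : ℝ => (x - ε • w) ⬝ᵥ castVec (M.col i) := by
        simp only [dotProduct, Pi.sub_apply, Pi.smul_apply]
        fun_prop
      have e1 := (h1.tendsto 0).eventually_lt_const (u := 1) (by simpa using h)
      have e2 := (h2.tendsto 0).eventually_lt_const (u := 1) (by simpa using h)
      filter_upwards [e1, e2] with ε h3 h4 using ⟨h3.le, h4.le⟩
  have hev' := (Filter.eventually_all.2 hev).filter_mono (nhdsWithin_le_nhds (s := Set.Ioi 0))
  obtain ⟨ε, h, hε⟩ := (hev'.and self_mem_nhdsWithin).exists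
  have hε' : (0 : ℝ) < ε := hε
  have := ((mem_extremePoints.1 hx).2 (x + ε • w)
    (mem_dualPolytope_columnPolytope.2 fun i => (h i).1) (x - ε • w)
    (mem_dualPolytope_columnPolytope.2 fun i => (h i).2)
    ⟨1 / 2, 1 / 2, by norm_num, by norm_num, by norm_num, by
      rw [← smul_add, add_add_sub_cancel, ← two_smul ℝ x, smul_smul]
      norm_num⟩).1
  rw [add_eq_left, smul_eq_zero] at this
  exact this.elim hε'.ne' hw0

lemma isIntegralPolytope_dualPolytope (hdec : HasIntegerDecomposition M)
    (hint : 0 ∈ interior (columnPolytope M)) :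
    IsIntegralPolytope (dualPolytope (columnPolytope M)) := by
  have hext : ∀ x ∈ (dualPolytope (columnPolytope M)).extremePoints ℝ, IsIntegerPoint x := by
    intro x hx
    have hz : ∀ γ : Fin d → ℤ, ∃ z : ℤ, x ⬝ᵥ castVec γ = z := fun γ => by
      have hγ := mem_span_tight_columns hdec (mem_dualPolytope_columnPolytope.1 hx.1)
        (span_tight_columns_eq_top hx) γ
      induction hγ using Submodule.span_induction with
      | mem c hc =>
        obtain ⟨i, hi, rfl⟩ := hc
        exact ⟨1, by simpa using hi⟩
      | zero => exact ⟨0, by simp⟩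
      | add a b _ _ ha hb =>
        obtain ⟨y, hy⟩ := ha
        obtain ⟨z, hz⟩ := hb
        exact ⟨y + z, by rw [map_add, dotProduct_add, hy, hz, Int.cast_add]⟩
      | smul n a _ ha =>
        obtain ⟨y, hy⟩ := ha
        exact ⟨n * y, by rw [map_zsmul, dotProduct_smul, hy, zsmul_eq_mul, Int.cast_mul]⟩
    choose z hz using fun k => hz (Pi.single k 1)
    refine ⟨z, funext fun k => ?_⟩
    rw [← hz k]
    have : castVec (Pi.single k 1) = Pi.single k (1 : ℝ) := by
      ext j
      rcases eq_or_ne j k with rfl | hj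
      · simp
      · simp [hj]
    rw [this, dotProduct_single, mul_one]
  obtain ⟨a, b, hab⟩ := exists_dualPolytope_subset_Icc hint
  have hfin : ((dualPolytope (columnPolytope M)).extremePoints ℝ).Finite :=
    (finite_integerPoints_inter hab).subset fun x hx => ⟨hx.1, hext x hx⟩
  have hcomp := Metric.isCompact_of_isClosed_isBounded
    (isClosed_dualPolytope (columnPolytope M)) ((Metric.isBounded_Icc a b).subset hab)
  refine ⟨⟨_, hfin, ?_⟩, hext⟩
  rw [← (hfin.isClosed_convexHull ℝ).closure_eq,
    closure_convexHull_extremePoints hcomp (convex_dualPolytope _)]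

lemma isGorensteinFano_columnPolytope (hdec : HasIntegerDecomposition M)
    (hint : 0 ∈ interior (columnPolytope M)) : IsGorensteinFano (columnPolytope M) := by
  refine ⟨⟨isIntegralPolytope_columnPolytope, dimension_columnPolytope hint,
    Set.Subset.antisymm ?_ ?_⟩, isIntegralPolytope_dualPolytope hdec hint⟩
  · rintro _ ⟨hx, γ, rfl⟩
    obtain ⟨ε, hε, hmem⟩ := exists_pos_add_smul_mem hx fun k => (γ k : ℝ)
    obtain ⟨w, hw0, hw1, hw⟩ := mem_columnPolytope_iff.1 hmem
    have h1 : 0 < 1 + ε := by linarith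
    -- The coefficients of `γ` have sum less than `1`.
    obtain ⟨k, hk, hsum⟩ := hdec γ (fun i => w i / (1 + ε))
      (fun i => div_nonneg (hw0 i) h1.le) fun k => by
        have := hw k
        simp only [Pi.add_apply, Pi.smul_apply, smul_eq_mul] at this
        simp only [div_mul_eq_mul_div, ← Finset.sum_div, ← this]
        field_simp
    rw [← Finset.sum_div, hw1, le_div_iff₀ h1] at hk
    have hk0 : k = 0 := by
      by_contra hne
      have : (1 : ℝ) ≤ k := by exact_mod_cast Nat.one_le_iff_ne_zero.2 hne
      nlinarith
    subst hk0
    rw [hsum.eq_zero]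
    ext k
    simp
  · rintro _ rfl
    exact ⟨hint, 0, by ext k; simp⟩

end Polytope

/-! ### Facets of simplicial polytopes -/

section Facet

variable {d : ℕ} {ι : Type*} {M : Matrix (Fin d) ι ℤ}

/-- A facet of a polytope with the origin in its interior lies on a hyperplane `⟨x, ·⟩ = 1`. -/
lemma exists_eq_of_isFacet (hint : 0 ∈ interior (columnPolytope M)) {F : Set (Fin d → ℝ)}
    (hF : IsFacet (columnPolytope M) F) :
    ∃ x : Fin d → ℝ, (∀ i, x ⬝ᵥ castVec (M.col i) ≤ 1) ∧
      F = {y ∈ columnPolytope M | x ⬝ᵥ y = 1} := by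
  classical
  obtain ⟨hne, hexp, hdim⟩ := hF
  obtain ⟨l, hl⟩ := hexp hne
  obtain ⟨y₀, hy₀⟩ := hne
  have hy₀' := hl ▸ hy₀
  have h0 : 0 ≤ l y₀ := by simpa using hy₀'.2 0 (interior_subset hint)
  have hpos : 0 < l y₀ := by
    refine lt_of_le_of_ne h0 fun h => ?_
    have hle : ∀ v, l v ≤ 0 := fun v => by
      obtain ⟨ε, hε, hmem⟩ := exists_pos_add_smul_mem hint v
      have := hy₀'.2 _ hmem
      rw [zero_add, map_smul, smul_eq_mul, ← h] at this
      by_contra! hv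
      nlinarith [mul_pos hε hv]
    have hl0 : ∀ v, l v = 0 := fun v => le_antisymm (hle v) (by
      have := hle (-v)
      rw [map_neg] at this
      linarith)
    have : F = columnPolytope M := by
      rw [hl]
      ext y
      simp [hl0]
    rw [this] at hdim
    omega
  have hx : ∀ y, (fun k => l (Pi.single k 1) / l y₀) ⬝ᵥ y = l y / l y₀ := fun y => by
    have h : l y = ∑ k, y k * l (Pi.single k 1) := by
      conv_lhs => rw [pi_eq_sum_univ' y]
      simp [map_sum]
    rw [h, Finset.sum_div]
    exact Finset.sum_congr rfl fun k _ => by ring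
  refine ⟨fun k => l (Pi.single k 1) / l y₀, fun i => ?_, ?_⟩
  · rw [hx, div_le_one hpos]
    exact hy₀'.2 _ (castVec_col_mem i)
  · conv_lhs => rw [hl]
    ext y
    simp only [Set.mem_ofPred_eq, hx, div_eq_one_iff_eq hpos.ne']
    refine and_congr_right fun hy => ⟨fun h => ?_, fun h z hz => ?_⟩
    · exact le_antisymm (hy₀'.2 y hy) (h y₀ hy₀'.1)
    · rw [h]
      exact hy₀'.2 z hz

/-- The `d` vertices of a simplicial facet span `ℝᵈ`, so the columns on the facet generate `ℤᵈ`.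
When the columns are in convex position, these columns are the vertices. -/
lemma exists_basis_of_isFacet [Fintype ι] (hdec : HasIntegerDecomposition M)
    (hint : 0 ∈ interior (columnPolytope M))
    (hconv : ∀ V ⊆ Set.range fun i => castVec (M.col i), ∀ i,
      castVec (M.col i) ∈ convexHull ℝ V → castVec (M.col i) ∈ V)
    (hsimp : IsSimplicial (columnPolytope M)) {F : Set (Fin d → ℝ)}
    (hF : IsFacet (columnPolytope M) F) :
    ∃ b : Module.Basis (Fin d) ℤ (Fin d → ℤ),
      F.extremePoints ℝ = Set.range fun i k => (b i k : ℝ) := by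
  classical
  obtain ⟨x, hx, hFx⟩ := exists_eq_of_isFacet hint hF
  have hai := hsimp.2 F hF
  have hVsub : F.extremePoints ℝ ⊆ Set.range fun i => castVec (M.col i) :=
    (hF.2.1.isExtreme.extremePoints_subset_extremePoints).trans extremePoints_columnPolytope_subset
  have hVfin : (F.extremePoints ℝ).Finite := (Set.finite_range _).subset hVsub
  have hFcomp : IsCompact F := hF.2.1.isCompact isCompact_columnPolytope
  have hFhull : convexHull ℝ (F.extremePoints ℝ) = F := by
    rw [← (hVfin.isClosed_convexHull ℝ).closure_eq,
      closure_convexHull_extremePoints hFcomp (hF.2.1.convex (convex_convexHull ℝ _))]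
  have hVx : ∀ v : F.extremePoints ℝ, x ⬝ᵥ (v : Fin d → ℝ) = 1 := fun v => by
    have h : ∀ y ∈ F, x ⬝ᵥ y = 1 := fun y hy => (hFx.subset hy).2
    exact h v v.2.1
  have : Fintype (F.extremePoints ℝ) := hVfin.fintype
  have : Nonempty (F.extremePoints ℝ) := (hFcomp.extremePoints_nonempty hF.1).to_subtype
  have hcard : Fintype.card (F.extremePoints ℝ) = d := by
    rw [← hai.finrank_vectorSpan_add_one, Subtype.range_coe]
    conv_rhs => rw [← dimension_columnPolytope hint, ← hF.2.2, dimension]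
    conv_rhs => rw [← hFhull, ← direction_affineSpan, affineSpan_convexHull, direction_affineSpan]
  -- Affinely independent points of a hyperplane that misses the origin are linearly independent.
  have hli : LinearIndependent ℝ fun v : F.extremePoints ℝ => (v : Fin d → ℝ) := by
    rw [Fintype.linearIndependent_iff]
    intro g hg v
    refine affineIndependent_iff.1 hai Finset.univ g ?_ hg v (Finset.mem_univ v)
    have h := congrArg (fun y => x ⬝ᵥ y) hg
    simpa [dotProduct_sum, dotProduct_smul, hVx] using h
  have hspan : Submodule.span ℝ
      (Set.range fun i : {i | x ⬝ᵥ castVec (M.col i) = 1} => castVec (M.col i)) = ⊤ := by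
    rw [eq_top_iff, ← hli.span_eq_top_of_card_eq_finrank' (by rw [hcard, Module.finrank_fin_fun])]
    refine Submodule.span_mono ?_
    rintro _ ⟨v, rfl⟩
    obtain ⟨i, hi⟩ := hVsub v.2
    refine ⟨⟨i, ?_⟩, hi⟩
    have := hVx v
    rw [← hi] at this
    exact this
  let e : Fin d ≃ F.extremePoints ℝ := (Fintype.equivFinOfCardEq hcard).symm
  choose z hz using fun i : Fin d => hVsub (e i).2
  have hli' : LinearIndependent ℤ fun i => M.col (z i) := by
    refine LinearIndependent.of_comp castVec ?_
    refine LinearIndependent.restrict_scalars (K := ℝ)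
      (fun a b h => by simpa using h) ?_
    have h : ⇑castVec ∘ (fun i => M.col (z i)) =
        (fun v : F.extremePoints ℝ => (v : Fin d → ℝ)) ∘ e := funext hz
    rw [h]
    exact hli.comp _ e.injective
  have hspan' : ⊤ ≤ Submodule.span ℤ (Set.range fun i => M.col (z i)) := by
    intro γ _
    refine Submodule.span_mono ?_ (mem_span_tight_columns hdec hx hspan γ)
    rintro _ ⟨j, hj, rfl⟩
    have hjF : castVec (M.col j) ∈ F := hFx.superset ⟨castVec_col_mem j, hj⟩
    have hjV := hconv _ hVsub j (hFhull.superset hjF)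
    refine ⟨e.symm ⟨_, hjV⟩, castVec_injective ?_⟩
    dsimp only
    have := hz (e.symm ⟨_, hjV⟩)
    rw [Equiv.apply_symm_apply] at this
    exact this
  refine ⟨Module.Basis.mk hli' hspan', ?_⟩
  have h : (fun (i : Fin d) (k : Fin d) => ((Module.Basis.mk hli' hspan' i k : ℤ) : ℝ)) =
      fun i => (e i : Fin d → ℝ) := by
    funext i
    rw [Module.Basis.mk_apply]
    exact hz i
  rw [h]
  ext v
  exact ⟨fun hv => ⟨e.symm ⟨v, hv⟩, by simp⟩, by rintro ⟨i, rfl⟩; exact (e i).2⟩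

end Facet

/-! ### Convex position of 0/1 vectors and negatives of 0/1 vectors -/

section ConvexPosition

variable {d : ℕ}

/-- A `0/1` vector `a` is the strict maximum of a linear functional, with weight `d + 1` on the
support of `a` and weight `-1` elsewhere, among all vectors with entries in `{0, 1}` or in
`{0, -1}`. -/
lemma castVec_mem_of_mem_convexHull {a : Fin d → ℤ} (ha : ∀ k, 0 ≤ a k ∧ a k ≤ 1) (ha0 : a ≠ 0)
    {V : Set (Fin d → ℝ)} (hV : ∀ v ∈ V, ∃ c : Fin d → ℤ, v = castVec c ∧
      ((∀ k, 0 ≤ c k ∧ c k ≤ 1) ∨ ∀ k, -1 ≤ c k ∧ c k ≤ 0))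
    (h : castVec a ∈ convexHull ℝ V) : castVec a ∈ V := by
  by_contra hnot
  let w : Fin d → ℤ := fun k => if a k = 1 then d + 1 else -1
  have hconv : Convex ℝ {y : Fin d → ℝ | castVec w ⬝ᵥ y < castVec w ⬝ᵥ castVec a} :=
    convex_halfSpace_lt (f := fun y => castVec w ⬝ᵥ y)
      ⟨dotProduct_add _, fun c y => dotProduct_smul c _ y⟩ _
  have hcast : ∀ c : Fin d → ℤ, castVec w ⬝ᵥ castVec c = ((w ⬝ᵥ c : ℤ) : ℝ) := fun c => by
    simp [dotProduct]
  have hd : ∀ _ : Fin d, (0 : ℤ) < d := fun k => by exact_mod_cast k.pos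
  refine lt_irrefl (castVec w ⬝ᵥ castVec a) (convexHull_min (fun v hv => ?_) hconv h)
  obtain ⟨c, rfl, hc⟩ := hV v hv
  have hca : c ≠ a := fun h => hnot (h ▸ hv)
  rw [Set.mem_ofPred_eq, hcast, hcast, Int.cast_lt]
  rcases hc with hc | hc
  · obtain ⟨k, hk⟩ := Function.ne_iff.1 hca
    refine Finset.sum_lt_sum (fun j _ => ?_) ⟨k, Finset.mem_univ k, ?_⟩
    · have := ha j
      have := hc j
      have := hd j
      dsimp only [w]
      split_ifs with h1
      · rw [h1]
        nlinarith
      · have : a j = 0 := by omega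
        rw [this]
        omega
    · have := ha k
      have := hc k
      have := hd k
      dsimp only [w]
      split_ifs with h1
      · have h2 : c k = 0 := by omega
        rw [h1, h2]
        omega
      · have : a k = 0 := by omega
        rw [this]
        omega
  · obtain ⟨k, hk⟩ := Function.ne_iff.1 ha0
    have hk1 : a k = 1 := by
      have := ha k
      simp only [Pi.zero_apply] at hk
      omega
    have h1 : w ⬝ᵥ c ≤ ∑ _j : Fin d, (1 : ℤ) := Finset.sum_le_sum fun j _ => by
      have := hc j
      have := hd j
      dsimp only [w]
      split_ifs
      · nlinarith
      · omega
    have h2 : w k * a k ≤ w ⬝ᵥ a := by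
      refine Finset.single_le_sum (f := fun j => w j * a j) (fun j _ => ?_) (Finset.mem_univ k)
      have := ha j
      dsimp only [w]
      split_ifs with h
      · rw [h]
        omega
      · have : a j = 0 := by omega
        simp [this]
    have h3 : w k * a k = d + 1 := by simp [w, hk1]
    simp at h1
    omega

end ConvexPosition

/-! ### The polytope of a harmonious pair -/

variable {d n m : ℕ} {A : Matrix (Fin d) (Fin n) ℤ} {B : Matrix (Fin d) (Fin m) ℤ}

lemma nonneg_of_mem_range_sharp (hA : ∀ k i, 0 ≤ A k i) :
    ∀ s ∈ Set.range (sharp A).col, 0 ≤ s := by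
  rintro _ ⟨_ | i, rfl⟩ k
  exacts [le_rfl, hA k i]

lemma OfHarmony.posPart_sub_mem (h : OfHarmony A B) :
    ∀ s ∈ Set.range (sharp A).col, ∀ t ∈ Set.range (sharp B).col,
      (s - t)⁺ ∈ Set.range (sharp A).col ∧ (s - t)⁻ ∈ Set.range (sharp B).col := by
  rintro _ ⟨p, rfl⟩ _ ⟨q, rfl⟩
  exact h p q

lemma OfHarmony.symm (h : OfHarmony A B) : OfHarmony B A := fun p q => by
  obtain ⟨h1, h2⟩ := h q p
  rw [← neg_sub, posPart_neg, negPart_neg]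
  exact ⟨h2, h1⟩

lemma insert_range_col_negJoin :
    insert 0 (Set.range (negJoin A B).col) =
      Set.range (sharp A).col ∪ {x | -x ∈ Set.range (sharp B).col} := by
  ext x
  constructor
  · rintro (rfl | ⟨j | i, rfl⟩)
    · exact Or.inl ⟨none, rfl⟩
    · refine Or.inr ⟨some j, ?_⟩
      ext k
      simp [sharp, negJoin, Matrix.col]
    · exact Or.inl ⟨some i, rfl⟩
  · rintro (⟨_ | i, rfl⟩ | ⟨_ | j, h⟩)
    · exact Or.inl rfl
    · exact Or.inr ⟨Sum.inr i, rfl⟩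
    · exact Or.inl (neg_eq_zero.1 h.symm)
    · refine Or.inr ⟨Sum.inl j, ?_⟩
      rw [← neg_neg x, ← h]
      rfl

/-- A sum of columns of `[-B, A]` can be normalized, without changing the number of summands, to a
sum of columns of `A` for the positive part and a sum of columns of `-B` for the negative part. -/
lemma OfHarmony.isSum_posPart_negPart (h : OfHarmony A B) (hA : ∀ k i, 0 ≤ A k i)
    (hB : ∀ k j, 0 ≤ B k j) {l : ℕ} {γ : Fin d → ℤ}
    (hγ : IsSum (insert 0 (Set.range (negJoin A B).col)) l γ) :
    ∃ p q, p + q = l ∧ IsSum (Set.range (sharp A).col) p γ⁺ ∧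
      IsSum (Set.range (sharp B).col) q γ⁻ := by
  rw [insert_range_col_negJoin] at hγ
  obtain ⟨p, q, σ, τ, hpq, hσ, hτ, rfl⟩ := hγ.exists_sub
  exact ⟨p, q, hpq, isSum_posPart_sub (nonneg_of_mem_range_sharp hA)
    (nonneg_of_mem_range_sharp hB) h.posPart_sub_mem hσ hτ⟩

end HarmonyFano

/-- The variables `z, x₁, …, x_n` of the polynomial ring of `I_{A♯}` are indexed by
`Option (Fin n)`, with `none` for `z`, and the variable orders inducing `<_A` and `<_B` are given
by their rank functions `ordA` and `ordB`. For `i ≠ j`, the monomial `π (x_i) = t ^ a_i * s` divides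
`π (x_j) = t ^ a_j * s` in `K[t, s]` exactly when `a_i ≤ a_j` in each coordinate. -/
theorem corollary1p3 {K : Type*} [Field K] {d n m : ℕ}
    (A : Matrix (Fin d) (Fin n) ℤ) (B : Matrix (Fin d) (Fin m) ℤ)
    (hA : ∀ k i, 0 ≤ A k i) (hB : ∀ k j, 0 ≤ B k j)
    (hA0 : ∀ i, A.col i ≠ 0) (hB0 : ∀ j, B.col j ≠ 0)
    (hharm : HarmonyFano.OfHarmony A B)
    (ordA : Option (Fin n) ≃ Fin (n + 1)) (ordB : Option (Fin m) ≃ Fin (m + 1))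
    (hdvd : ∀ i j, i ≠ j → (∀ k, A k i ≤ A k j) → ordA (some i) < ordA (some j))
    (hzA : ∀ i, ordA none < ordA (some i)) (hzB : ∀ j, ordB none < ordB (some j))
    (hsqA : HarmonyFano.IsSquarefreeMonomialIdeal
      (HarmonyFano.initialIdeal (HarmonyFano.RevLexLT ordA)
        (HarmonyFano.toricIdeal K (HarmonyFano.sharp A))))
    (hsqB : HarmonyFano.IsSquarefreeMonomialIdeal
      (HarmonyFano.initialIdeal (HarmonyFano.RevLexLT ordB)
        (HarmonyFano.toricIdeal K (HarmonyFano.sharp B))))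
    (hint : (0 : Fin d → ℝ) ∈ interior (HarmonyFano.columnPolytope (HarmonyFano.negJoin A B)))
    (hminor : ∃ f : Fin d → Fin m ⊕ Fin n,
      ((HarmonyFano.negJoin A B).submatrix id f).det = 1 ∨
        ((HarmonyFano.negJoin A B).submatrix id f).det = -1) :
    HarmonyFano.IsGorensteinFano (HarmonyFano.columnPolytope (HarmonyFano.negJoin A B)) ∧
      (HarmonyFano.IsSimplicial (HarmonyFano.columnPolytope (HarmonyFano.negJoin A B)) →
        HarmonyFano.IsSmoothFano (HarmonyFano.columnPolytope (HarmonyFano.negJoin A B))) := by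
  -- Homogeneity of the numbers of summands over `A` and over `B`.
  have hhomA : ∀ {α : Fin d → ℤ} {k₀ N l : ℕ},
      HarmonyFano.IsSum (Set.range (HarmonyFano.sharp A).col) k₀ α →
      HarmonyFano.IsSum (Set.range (HarmonyFano.sharp A).col) l (N • α) →
      ∃ k, N * k ≤ l ∧ HarmonyFano.IsSum (Set.range (HarmonyFano.sharp A).col) k α :=
    HarmonyFano.exists_isSum_of_nsmul A ordA hzA hsqA
  have hhomB : ∀ {α : Fin d → ℤ} {k₀ N l : ℕ},
      HarmonyFano.IsSum (Set.range (HarmonyFano.sharp B).col) k₀ α →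
      HarmonyFano.IsSum (Set.range (HarmonyFano.sharp B).col) l (N • α) →
      ∃ k, N * k ≤ l ∧ HarmonyFano.IsSum (Set.range (HarmonyFano.sharp B).col) k α :=
    HarmonyFano.exists_isSum_of_nsmul B ordB hzB hsqB
  have hgen : ∀ γ, ∃ k,
      HarmonyFano.IsSum (insert 0 (Set.range (HarmonyFano.negJoin A B).col)) k γ := fun γ => by
    obtain ⟨u, rfl⟩ := HarmonyFano.exists_eq_sum_nsmul_col hint hminor γ
    exact ⟨_, HarmonyFano.IsSum.finset_sum _ fun i _ =>
      Set.mem_insert_of_mem _ (Set.mem_range_self i)⟩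
  have hgenA : ∀ α : Fin d → ℤ, 0 ≤ α →
      ∃ p, HarmonyFano.IsSum (Set.range (HarmonyFano.sharp A).col) p α := fun α hα => by
    obtain ⟨l, hl⟩ := hgen α
    obtain ⟨p, q, -, hp, -⟩ := hharm.isSum_posPart_negPart hA hB hl
    exact ⟨p, by rwa [posPart_of_nonneg hα] at hp⟩
  have hgenB : ∀ α : Fin d → ℤ, 0 ≤ α →
      ∃ q, HarmonyFano.IsSum (Set.range (HarmonyFano.sharp B).col) q α := fun α hα => by
    obtain ⟨l, hl⟩ := hgen (-α)
    obtain ⟨p, q, -, -, hq⟩ := hharm.isSum_posPart_negPart hA hB hl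
    exact ⟨q, by rwa [negPart_neg, posPart_of_nonneg hα] at hq⟩
  -- Homogeneity over `[-B, A]`, since positive and negative parts can be treated separately.
  have hdec : HarmonyFano.HasIntegerDecomposition (HarmonyFano.negJoin A B) := by
    refine HarmonyFano.hasIntegerDecomposition_of_homogeneous hgen fun γ N l hl => ?_
    obtain ⟨p, q, rfl, hp, hq⟩ := hharm.isSum_posPart_negPart hA hB hl
    have e1 : (N • γ)⁺ = N • γ⁺ := by
      ext k
      simp [posPart_def, mul_max_of_nonneg]
    have e2 : (N • γ)⁻ = N • γ⁻ := by
      ext k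
      simp [negPart_def, mul_max_of_nonneg]
    rw [e1] at hp
    rw [e2] at hq
    obtain ⟨p₀, hp₀⟩ := hgenA _ (posPart_nonneg γ)
    obtain ⟨q₀, hq₀⟩ := hgenB _ (negPart_nonneg γ)
    obtain ⟨p', hp', hp'sum⟩ := hhomA hp₀ hp
    obtain ⟨q', hq', hq'sum⟩ := hhomB hq₀ hq
    refine ⟨p' + q', by rw [mul_add]; omega, ?_⟩
    rw [HarmonyFano.insert_range_col_negJoin, ← posPart_sub_negPart γ, sub_eq_add_neg]
    exact (hp'sum.subset Set.subset_union_left).add (hq'sum.neg.subset Set.subset_union_right)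
  have hGor := HarmonyFano.isGorensteinFano_columnPolytope hdec hint
  refine ⟨hGor, fun hsimp => ⟨hGor.1, hsimp, fun F hF =>
    HarmonyFano.exists_basis_of_isFacet hdec hint ?_ hsimp hF⟩⟩
  have hA1 : ∀ k i, A k i ≤ 1 := fun k i =>
    HarmonyFano.apply_le_one_of_harmony (HarmonyFano.nonneg_of_mem_range_sharp hA)
      (HarmonyFano.nonneg_of_mem_range_sharp hB) hharm.posPart_sub_mem hgenB
      (fun α N l hα hl => (hgenA α hα).elim fun _ h => hhomA h hl) ⟨some i, rfl⟩ k
  have hB1 : ∀ k j, B k j ≤ 1 := fun k j =>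
    HarmonyFano.apply_le_one_of_harmony (HarmonyFano.nonneg_of_mem_range_sharp hB)
      (HarmonyFano.nonneg_of_mem_range_sharp hA) hharm.symm.posPart_sub_mem hgenA
      (fun α N l hα hl => (hgenB α hα).elim fun _ h => hhomB h hl) ⟨some j, rfl⟩ k
  have hcols : ∀ i : Fin m ⊕ Fin n,
      (∀ k, 0 ≤ (HarmonyFano.negJoin A B).col i k ∧ (HarmonyFano.negJoin A B).col i k ≤ 1) ∨
        ∀ k, -1 ≤ (HarmonyFano.negJoin A B).col i k ∧
          (HarmonyFano.negJoin A B).col i k ≤ 0 := by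
    rintro (j | i)
    · refine Or.inr fun k => ?_
      have h1 := hB k j
      have h2 := hB1 k j
      simp [HarmonyFano.negJoin, Matrix.col]
      omega
    · exact Or.inl fun k => ⟨hA k i, hA1 k i⟩
  intro V hV i hi
  rcases i with j | i
  · -- For a column of `-B`, reflect in the origin.
    have hneg : HarmonyFano.castVec (B.col j) =
        -HarmonyFano.castVec ((HarmonyFano.negJoin A B).col (Sum.inl j)) := by
      rw [← map_neg]
      congr 1
      ext k
      simp [HarmonyFano.negJoin, Matrix.col]
    have h := HarmonyFano.castVec_mem_of_mem_convexHull (a := B.col j) (V := -V)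
      (fun k => ⟨hB k j, hB1 k j⟩) (hB0 j) (fun v hv => ?_)
      (by rw [convexHull_neg, hneg]; simpa using hi)
    · rw [hneg] at h
      simpa using h
    · obtain ⟨i', hi'⟩ := hV hv
      refine ⟨-(HarmonyFano.negJoin A B).col i', by rw [map_neg]; simp [hi'], ?_⟩
      rcases hcols i' with h | h
      · refine Or.inr fun k => ?_
        have := h k
        simp only [Pi.neg_apply]
        omega
      · refine Or.inl fun k => ?_
        have := h k
        simp only [Pi.neg_apply]
        omega
  · refine HarmonyFano.castVec_mem_of_mem_convexHull (fun k => ⟨hA k i, hA1 k i⟩) (hA0 i)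
      (fun v hv => ?_) hi
    obtain ⟨i', hi'⟩ := hV hv
    exact ⟨_, hi'.symm, hcols i'⟩
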